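/- Strings are elements of $\{0,1\}^*$, sequences are elements of $\{0,1\}^\omega$, and $S\upharpoonright n$ is the prefix of length $n$ of $S$. **Transducers.** A finite-state transducer (FST) has a finite non-empty state set $Q$ (named $0,\dots,|Q|-1$), a start state $q_0$, a transition function $Q\times\{0,1\}\to Q$ and an output function $Q\times\{0,1\}\to\{0,1\}^*$; $T(x)$ is the concatenation of its outputs while it reads $x$. It is information lossless (an ILFST) if $x\mapsto(T(x),\text{final state on }x)$ is injective. A pebble transducer (PB) is a deterministic two-way transducer with finitely many states (named in the same way), a set of final states and $k$ pebbles, for some $k\ge 0$, working on the tape $\dashv x\vdash$ with its head starting on $\dashv$ and no pebble on the tape. According to its non-final state, the scanned symbol and the set of pebbles on the scanned square, it writes a string, changes state, and either moves one square right (impossible on $\vdash$), moves one square left (impossible on $\dashv$), places the next pebble on the current square (impossible if all $k$ are on the tape), or removes the last placed pebble (possible only if that pebble is on the current square); impossible actions are undefined. It outputs $w$ on $x$ if it reaches a final state, having written $w$. **Complexity.** A binary representation of a class $F$ of transducers is a computable surjection $\sigma:D\to F$ from an infinite computable set $D\subseteq\{0,1\}^*$; the size of $T\in F$ is the minimal length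 of a $d\in D$ with $\sigma(d)=T$. Let $D^k_{F}(x)\in\mathbb N\cup\{\infty\}$ be the minimal length of a string $y$ such that some $T\in F$ of size at most $k$ outputs $x$ on input $y$ ($\infty$ if there is none). **Depth.** With respect to binary representations of FSTs and of PBs, $\text{PB-depth}(S)\ge\alpha$ means $$(\forall k\in\mathbb N)(\exists k'\in\mathbb N)(\forall^\infty n)\quad D^k_{FS}(S\upharpoonright n)-D^{k'}_{PB}(S\upharpoonright n)\ge\alpha n ,$$ where $\infty-m=\infty$ for $m<\infty$, and the inequality counts as false if both terms are infinite. The Lempel–Ziv 78 algorithm parses $x$ into phrases $x_1x_2\cdots x_m$, each phrase ending as soon as it differs from all previous phrases (only the last one may be a repetition); with $x_0=\lambda$, $x_i=x_{l(i)}b_i$, $l(i)<i$, $b_i\in\{0,1\}$, and a prefix-free encoding $(c_j)_{j\in\mathbb N}$ of the pointers, it outputs $LZ(x)=c_{l(1)}b_1\cdots c_{l(m)}b_m$. $\text{LZ-depth}(S)\ge\alpha$ means that for every ILFST $C$, for almost all $n$, $|C(S\upharpoonright n)|-|LZ(S\upharpoonright n)|\ge\alpha n$; otherwise $\text{LZ-depth}(S)<\alpha$.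 **Theorem.** For every real $\beta$ with $0<\beta<\tfrac12$ there exists a sequence $S\in\{0,1\}^\omega$ such that $$\text{PB-depth}(S)\ge\tfrac12-\beta\quad\text{and}\quad\text{LZ-depth}(S)<\beta ,$$ the first for every choice of the binary representations of FSTs and PBs, the second for every prefix-free encoding of the pointers of the Lempel–Ziv algorithm. -/

import Mathlib

/-! ### Strings and sequences

A string is a `List Bool`, a sequence is a function `ℕ → Bool`. -/

namespace PebbleDepth

/-- The prefix of length `n` of the sequence `S`. -/
def seqPrefix (S : ℕ → Bool) (n : ℕ) : List Bool :=
  (List.range n).map S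

/-! ### Finite-state transducers -/

/-- A finite-state transducer; its states are named `0, …, numStates - 1`. -/
structure FST where
  numStates : ℕ
  start : Fin numStates
  step : Fin numStates → Bool → Fin numStates
  out : Fin numStates → Bool → List Bool

namespace FST

/-- The state reached from the start state after reading `x`. -/
def finalState (T : FST) (x : List Bool) : Fin T.numStates :=
  x.foldl T.step T.start

/-- The output produced when `x` is read from state `q`. -/
def outputFrom (T : FST) : Fin T.numStates → List Bool → List Bool
  | _, [] => []
  | q, b :: x => T.out q b ++ outputFrom T (T.step q b) x

/-- The output `T(x)`. -/
def output (T : FST) (x : List Bool) : List Bool :=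
  T.outputFrom T.start x

/-- `T` is information lossless: output and final state together determine the input. -/
def IsInformationLossless (T : FST) : Prop :=
  Function.Injective fun x : List Bool => (T.output x, T.finalState x)

end FST

/-! ### Pebble transducers -/

/-- The symbols on the tape: input bits, the left end marker and the right end marker. -/
inductive TapeSymbol where
  | bit (b : Bool)
  | leftEnd
  | rightEnd
  deriving DecidableEq

/-- The actions `+1`, `-1`, push and pop. -/
inductive PebbleAction where
  | moveRight
  | moveLeft
  | push
  | pop

/-- A deterministic pebble transducer; its states are named `0, …, numStates - 1`. The last argument
of the transition and output functions tells which pebbles lie on the current square. -/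
structure PebbleTransducer where
  numStates : ℕ
  start : Fin numStates
  final : Finset (Fin numStates)
  pebbles : ℕ
  step : {q : Fin numStates // q ∉ final} → TapeSymbol → (Fin pebbles → Bool) →
    Fin numStates × PebbleAction
  out : {q : Fin numStates // q ∉ final} → TapeSymbol → (Fin pebbles → Bool) → List Bool

/-- The symbol on square `i` of the tape that holds the input `x` between its two end markers
(squares `0, …, |x| + 1`). -/
def tapeSymbol (x : List Bool) (i : ℕ) : TapeSymbol :=
  if i = 0 then .leftEnd
  else match x[i - 1]? with
    | some b => .bit b
    | none => .rightEnd

namespace PebbleTransducer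

/-- A configuration. Since pebbles are placed and lifted in stack order, the pebbles on the tape
are always the pebbles `1, …, l` for some `l`; `placed` lists their squares in this order. -/
structure Config (T : PebbleTransducer) where
  state : Fin T.numStates
  head : ℕ
  placed : List ℕ
  written : List Bool

/-- The initial configuration. -/
def initialConfig (T : PebbleTransducer) : T.Config :=
  ⟨T.start, 0, [], []⟩

/-- The successor configuration on input `x`, if there is one: final states have no successor, and
neither have configurations in which the prescribed action is impossible. -/
def next (T : PebbleTransducer) (x : List Bool) (c : T.Config) : Option T.Config :=
  if h : c.state ∈ T.final then none
  else
    let a := tapeSymbol x c.head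
    let b : Fin T.pebbles → Bool := fun j => decide (c.placed[(j : ℕ)]? = some c.head)
    let q := (T.step ⟨c.state, h⟩ a b).1
    let w := c.written ++ T.out ⟨c.state, h⟩ a b
    match (T.step ⟨c.state, h⟩ a b).2 with
    | .moveRight => if a = .rightEnd then none else some ⟨q, c.head + 1, c.placed, w⟩
    | .moveLeft => if a = .leftEnd then none else some ⟨q, c.head - 1, c.placed, w⟩
    | .push =>
        if c.placed.length < T.pebbles then some ⟨q, c.head, c.placed ++ [c.head], w⟩ else none
    | .pop =>
        if c.placed.getLast? = some c.head then some ⟨q, c.head, c.placed.dropLast, w⟩ else none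

/-- `T(x) = w`: on input `x`, the computation of `T` reaches a final state, having written `w`. -/
def Outputs (T : PebbleTransducer) (x w : List Bool) : Prop :=
  ∃ c : T.Config,
    Relation.ReflTransGen (fun c₁ c₂ => T.next x c₁ = some c₂) T.initialConfig c ∧
      c.state ∈ T.final ∧ c.written = w

end PebbleTransducer

/-! ### Binary representations and complexity -/

/-- What the notions below need to know about a class of transducers: when a transducer outputs a
given string on a given input, and which families of transducers, indexed by a decidable set `D` of
strings, are computable. It is only used for `FST` and `PebbleTransducer`. -/
class TransducerClass (F : Type) where
  Outputs : F → List Bool → List Bool → Prop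
  IsComputableFamily : {D : Set (List Bool)} → (D → F) → Prop

/-- A family of finite-state transducers is computable if the number of states, the start state
and the transition and output functions of `σ x` can be computed from `x`. -/
instance : TransducerClass FST where
  Outputs T y x := T.output y = x
  IsComputableFamily {D} σ :=
    (∃ f : List Bool → ℕ × ℕ, Computable f ∧
      ∀ x : D, f x = ((σ x).numStates, ((σ x).start : ℕ))) ∧
    (∃ g : List Bool × ℕ × Bool → ℕ × List Bool, Computable g ∧
      ∀ (x : D) (q : Fin (σ x).numStates) (b : Bool),
        g (x, q, b) = (((σ x).step q b : ℕ), (σ x).out q b))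

/-- A number for each tape symbol. -/
def TapeSymbol.code : TapeSymbol → ℕ
  | .bit false => 0
  | .bit true => 1
  | .leftEnd => 2
  | .rightEnd => 3

/-- A number for each action. -/
def PebbleAction.code : PebbleAction → ℕ
  | .moveRight => 0
  | .moveLeft => 1
  | .push => 2
  | .pop => 3

/-- A family of pebble transducers is computable if the number of states, the start state, the
number of pebbles, the set of final states and the transition and output functions of `σ x` can be
computed from `x`. -/
instance : TransducerClass PebbleTransducer where
  Outputs := PebbleTransducer.Outputs
  IsComputableFamily {D} σ :=
    (∃ f : List Bool → ℕ × ℕ × ℕ, Computable f ∧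
      ∀ x : D, f x = ((σ x).numStates, ((σ x).start : ℕ), (σ x).pebbles)) ∧
    (∃ e : List Bool × ℕ → Bool, Computable e ∧
      ∀ (x : D) (q : Fin (σ x).numStates), e (x, q) = true ↔ q ∈ (σ x).final) ∧
    (∃ g : List Bool × ℕ × ℕ × List Bool → ℕ × ℕ × List Bool, Computable g ∧
      ∀ (x : D) (q : {q : Fin (σ x).numStates // q ∉ (σ x).final}) (a : TapeSymbol)
        (b : Fin (σ x).pebbles → Bool),
        g (x, q, a.code, List.ofFn b) =
          (((σ x).step q a b).1.val, ((σ x).step q a b).2.code, (σ x).out q a b))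

/-- A binary representation of the transducers in `F`: a computable map from an infinite computable
set of strings onto `F`. -/
structure BinaryRepresentation (F : Type) [TransducerClass F] where
  dom : Set (List Bool)
  infinite_dom : dom.Infinite
  computable_dom : ComputablePred fun x : List Bool => x ∈ dom
  toFun : dom → F
  computable_toFun : TransducerClass.IsComputableFamily toFun
  surjective_toFun : Function.Surjective toFun

namespace BinaryRepresentation

variable {F : Type} [TransducerClass F]

/-- The size of `T` with respect to `σ`: the length of its shortest description. -/
noncomputable def size (σ : BinaryRepresentation F) (T : F) : ℕ :=
  sInf {m : ℕ | ∃ x : σ.dom, σ.toFun x = T ∧ (x : List Bool).length = m}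

/-- The `k`-complexity of `x` with respect to `σ`: the length of a shortest input from which a
transducer of size at most `k` outputs `x`, and `⊤` if there is no such input. -/
noncomputable def complexity (σ : BinaryRepresentation F) (k : ℕ) (x : List Bool) : ℕ∞ :=
  sInf {m : ℕ∞ | ∃ (T : F) (y : List Bool),
    σ.size T ≤ k ∧ TransducerClass.Outputs T y x ∧ m = (y.length : ℕ∞)}

end BinaryRepresentation

/-- `PB-depth(S) ≥ α`, with respect to given binary representations of the finite-state and of the
pebble transducers. In `EReal` one has `⊤ - ⊤ = ⊥`, so the inequality fails if both complexities are
infinite. -/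
def PBDepthGE (σFS : BinaryRepresentation FST) (σPB : BinaryRepresentation PebbleTransducer)
    (S : ℕ → Bool) (α : ℝ) : Prop :=
  ∀ k : ℕ, ∃ k' : ℕ, ∀ᶠ n : ℕ in Filter.atTop,
    ((α * n : ℝ) : EReal) ≤
      ((σFS.complexity k (seqPrefix S n) : ENNReal) : EReal) -
        ((σPB.complexity k' (seqPrefix S n) : ENNReal) : EReal)

/-! ### The Lempel-Ziv 78 algorithm -/

/-- The Lempel-Ziv parsing, given the list `phrases` of the phrases found so far, the part `w` of
the current phrase that has been read, and the remaining input. A phrase ends as soon as it differs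
from all the previous ones; only the last phrase may be a repetition. -/
def lzParseAux (phrases : List (List Bool)) (w : List Bool) : List Bool → List (List Bool)
  | [] => if w = [] then phrases else phrases ++ [w]
  | b :: x =>
      if w ++ [b] ∈ phrases then lzParseAux phrases (w ++ [b]) x
      else lzParseAux (phrases ++ [w ++ [b]]) [] x

/-- The phrases `x₁, …, x_m` of the Lempel-Ziv parsing of `x`. -/
def lzPhrases (x : List Bool) : List (List Bool) :=
  lzParseAux [] [] x

/-- A prefix-free encoding of the natural numbers (pointers). -/
def IsPrefixFree (c : ℕ → List Bool) : Prop :=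
  ∀ i j : ℕ, c i <+: c j → i = j

/-- The Lempel-Ziv code of `x`. Every phrase is encoded as the pointer to its longest proper prefix
in the dictionary `x₀ = λ, x₁, x₂, …`, followed by its last bit; `c` encodes the pointers. -/
def lz (c : ℕ → List Bool) (x : List Bool) : List Bool :=
  (lzPhrases x).flatMap fun p =>
    c (([] :: lzPhrases x).idxOf p.dropLast) ++ p.getLast?.toList

/-- `LZ-depth(S) ≥ α`, where the Lempel-Ziv algorithm uses the encoding `c` of its pointers. -/
def LZDepthGE (c : ℕ → List Bool) (S : ℕ → Bool) (α : ℝ) : Prop :=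
  ∀ C : FST, C.IsInformationLossless →
    ∀ᶠ n : ℕ in Filter.atTop,
      α * n ≤ ((C.output (seqPrefix S n)).length : ℝ) - ((lz c (seqPrefix S n)).length : ℝ)

/-- `LZ-depth(S) < α`. -/
def LZDepthLT (c : ℕ → List Bool) (S : ℕ → Bool) (α : ℝ) : Prop :=
  ¬ LZDepthGE c S α

end PebbleDepth

namespace PebbleDepth

/-! ### An enumeration of all strings by length -/

/-! The witness is a Champernowne-type sequence: all non-empty strings, ordered by length and,
within a length, with the least significant bit first. This order makes the four strings `00r`,
`10r`, `01r`, `11r` consecutive, so that after an initial `01` the sequence is the concatenation of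
the words `block r`, with `r` running through all strings in the same order.

Neither finite-state transducers nor Lempel–Ziv compress it, and both facts follow from one count
(`length_mul_le_sum_length`): distinct strings, tagged from a fixed finite set, have total length
close to that of the first strings in the enumeration. If a finite-state transducer outputs a
concatenation of distinct words, its input splits into pieces, one per word, and a piece together
with bounded boundary data determines its word. For Lempel–Ziv, the phrases are exactly the
enumerated strings, and the pointer code tagged with the last bit determines the phrase. Hence the
identity transducer beats Lempel–Ziv by at most a small linear term at infinitely many prefixes,
which bounds the LZ-depth.

A two-way head can reread `r` four times. From a code of length `2|r| + 2` a transducer without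
pebbles writes `block r`, of length `4(|r| + 2)`: ratio at most `1/2`. The unfinished last block is
copied literally and has only logarithmic length. The gap between the rates `1` and `1/2` gives the
PB-depth. -/

/-- The enumeration `λ, 0, 1, 00, 10, 01, 11, …` of all strings by length. -/
def nthString : ℕ → List Bool
  | 0 => []
  | k + 1 => decide (k % 2 = 1) :: nthString (k / 2)

theorem nthString_zero : nthString 0 = [] := by rw [nthString]

theorem nthString_succ (k : ℕ) :
    nthString (k + 1) = decide (k % 2 = 1) :: nthString (k / 2) := by rw [nthString]

theorem nthString_odd (k : ℕ) : nthString (2 * k + 1) = false :: nthString k := by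
  rw [nthString_succ, show 2 * k / 2 = k by omega, show 2 * k % 2 = 0 by omega]; rfl

theorem nthString_even (k : ℕ) : nthString (2 * k + 2) = true :: nthString k := by
  rw [nthString_succ, show (2 * k + 1) / 2 = k by omega, show (2 * k + 1) % 2 = 1 by omega]; rfl

theorem nthString_cons (b : Bool) (k : ℕ) :
    nthString (2 * k + 1 + b.toNat) = b :: nthString k := by
  cases b
  · exact nthString_odd k
  · exact nthString_even k

theorem exists_nthString_eq (x : List Bool) : ∃ k, nthString k = x := by
  induction x with
  | nil => exact ⟨0, nthString_zero⟩
  | cons b x ih =>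
    obtain ⟨k, rfl⟩ := ih
    exact ⟨_, nthString_cons b k⟩

theorem nthString_injective : Function.Injective nthString := by
  intro i
  induction i using Nat.strong_induction_on with
  | _ i ih =>
    intro j h
    cases i with
    | zero => cases j with
      | zero => rfl
      | succ j => simp [nthString_zero, nthString_succ] at h
    | succ i => cases j with
      | zero => simp [nthString_zero, nthString_succ] at h
      | succ j =>
        simp only [nthString_succ, List.cons.injEq, decide_eq_decide] at h
        have := ih (i / 2) (by omega) h.2
        omega

theorem two_pow_length_nthString_le (k : ℕ) : 2 ^ (nthString k).length ≤ k + 1 := by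
  induction k using Nat.strong_induction_on with
  | _ k ih =>
    cases k with
    | zero => simp [nthString_zero]
    | succ k =>
      have := ih (k / 2) (by omega)
      rw [nthString_succ, List.length_cons, pow_succ]
      omega

theorem lt_two_pow_length_nthString (k : ℕ) : k + 1 < 2 ^ ((nthString k).length + 1) := by
  induction k using Nat.strong_induction_on with
  | _ k ih =>
    cases k with
    | zero => simp [nthString_zero]
    | succ k =>
      have := ih (k / 2) (by omega)
      rw [nthString_succ, List.length_cons, pow_succ]
      omega

/-- The block of `nthString q` consists of the strings with indices `4q + 3` to `4q + 6`, all of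
length `|nthString q| + 2`; earlier strings are no longer. -/
theorem length_nthString_le {q k : ℕ} (h : k ≤ 4 * q + 2) :
    (nthString k).length ≤ (nthString q).length + 2 := by
  have h1 := two_pow_length_nthString_le k
  have h2 := lt_two_pow_length_nthString q
  have h3 : 2 ^ (nthString k).length < 2 ^ ((nthString q).length + 3) := by
    rw [pow_add] at h2 ⊢
    omega
  have := (Nat.pow_lt_pow_iff_right (by norm_num)).1 h3
  omega

/-- Removing final bits never increases the index, so every proper prefix of a string is enumerated
before it. This is what makes the Lempel–Ziv phrases coincide with the enumerated strings. -/
theorem exists_nthString_eq_of_prefix {p : List Bool} {k : ℕ} (h : p <+: nthString k) :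
    ∃ j ≤ k, p = nthString j := by
  induction k using Nat.strong_induction_on generalizing p with
  | _ k ih =>
    cases p with
    | nil => exact ⟨0, Nat.zero_le _, nthString_zero.symm⟩
    | cons b p =>
      cases k with
      | zero => simp [nthString_zero] at h
      | succ k =>
        rw [nthString_succ, List.cons_prefix_cons] at h
        obtain ⟨j, hj, rfl⟩ := ih (k / 2) (by omega) h.2
        refine ⟨_, ?_, (nthString_cons b j).symm⟩
        rcases Nat.mod_two_eq_zero_or_one k with hk | hk
        · have : b = false := by simpa [hk] using h.1
          subst this
          simp only [Bool.toNat_false]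
          omega
        · have : b = true := by simpa [hk] using h.1
          subst this
          simp only [Bool.toNat_true]
          omega

/-! ### The sequence that concatenates all strings -/

/-- The concatenation of the first `m` non-empty strings. -/
def concatStrings (m : ℕ) : List Bool :=
  (List.range m).flatMap fun i => nthString (i + 1)

theorem concatStrings_succ (m : ℕ) :
    concatStrings (m + 1) = concatStrings m ++ nthString (m + 1) := by
  simp [concatStrings, List.range_succ]

theorem concatStrings_prefix {m m' : ℕ} (h : m ≤ m') : concatStrings m <+: concatStrings m' := by
  induction h with
  | refl => exact List.prefix_rfl
  | step _ ih => exact ih.trans (by rw [concatStrings_succ]; exact List.prefix_append _ _)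

/-- Each concatenated string is non-empty. In particular the default value in `allStringsSeq` is
never used. -/
theorem le_length_concatStrings (m : ℕ) : m ≤ (concatStrings m).length := by
  induction m with
  | zero => simp
  | succ m ih =>
    rw [concatStrings_succ, List.length_append, nthString_succ, List.length_cons]
    omega

/-- The sequence `0 1 00 10 01 11 …` that concatenates all strings. -/
def allStringsSeq (n : ℕ) : Bool :=
  (concatStrings (n + 1)).getD n false

theorem seqPrefix_allStringsSeq {n m : ℕ} (h : n ≤ (concatStrings m).length) :
    seqPrefix allStringsSeq n = (concatStrings m).take n := by
  refine List.ext_getElem (by simp [seqPrefix, h]) fun i h1 h2 => ?_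
  have hi : i < (concatStrings m).length := by
    rw [List.length_take] at h2
    omega
  have hi' : i < (concatStrings (i + 1)).length := le_length_concatStrings (i + 1)
  simp only [seqPrefix, List.getElem_map, List.getElem_range, List.getElem_take, allStringsSeq,
    List.getD_eq_getElem _ _ hi']
  rcases le_total m (i + 1) with hm | hm
  · exact ((concatStrings_prefix hm).getElem hi).symm
  · exact (concatStrings_prefix hm).getElem hi'

/-- The four strings that arise from `r` by prepending two bits, concatenated. -/
def block (r : List Bool) : List Bool :=
  (false :: false :: r) ++ (true :: false :: r) ++ (false :: true :: r) ++ (true :: true :: r)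

theorem length_block (r : List Bool) : (block r).length = 4 * (r.length + 2) := by
  simp [block]; ring

theorem concatStrings_add_four (q : ℕ) :
    concatStrings (4 * (q + 1) + 2) = concatStrings (4 * q + 2) ++ block (nthString q) := by
  have h1 : nthString (4 * q + 2 + 1) = false :: false :: nthString q := by
    rw [show 4 * q + 2 + 1 = 2 * (2 * q + 1) + 1 by ring, nthString_odd, nthString_odd]
  have h2 : nthString (4 * q + 2 + 1 + 1) = true :: false :: nthString q := by
    rw [show 4 * q + 2 + 1 + 1 = 2 * (2 * q + 1) + 2 by ring, nthString_even, nthString_odd]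
  have h3 : nthString (4 * q + 2 + 1 + 1 + 1) = false :: true :: nthString q := by
    rw [show 4 * q + 2 + 1 + 1 + 1 = 2 * (2 * q + 2) + 1 by ring, nthString_odd, nthString_even]
  have h4 : nthString (4 * q + 2 + 1 + 1 + 1 + 1) = true :: true :: nthString q := by
    rw [show 4 * q + 2 + 1 + 1 + 1 + 1 = 2 * (2 * q + 2) + 2 by ring, nthString_even,
      nthString_even]
  rw [show 4 * (q + 1) + 2 = 4 * q + 2 + 1 + 1 + 1 + 1 by ring]
  simp only [concatStrings_succ (4 * q + 2 + 1 + 1 + 1), concatStrings_succ (4 * q + 2 + 1 + 1),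
    concatStrings_succ (4 * q + 2 + 1), concatStrings_succ (4 * q + 2), h1, h2, h3, h4, block,
    List.append_assoc]

theorem concatStrings_eq_blocks (q : ℕ) :
    concatStrings (4 * q + 2) =
      [false, true] ++ ((List.range q).map nthString).flatMap block := by
  induction q with
  | zero => simp [concatStrings, List.range_succ, nthString]
  | succ q ih => rw [concatStrings_add_four, ih]; simp [List.range_succ]

/-- A long prefix is cut at its last complete block; what remains is a part of the block of
`nthString q`. -/
theorem seqPrefix_eq_concatStrings_append {Q n : ℕ}
    (h : (concatStrings (4 * Q + 2)).length ≤ n) :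
    ∃ q ≥ Q, ∃ tail : List Bool,
      seqPrefix allStringsSeq n = concatStrings (4 * q + 2) ++ tail ∧
        tail.length ≤ 4 * ((nthString q).length + 2) := by
  have hex : ∃ p, n < (concatStrings (4 * p + 2)).length :=
    ⟨n, by have := le_length_concatStrings (4 * n + 2); omega⟩
  have hlt : Q < Nat.find hex := by
    by_contra! hle
    have := (concatStrings_prefix (by omega : 4 * Nat.find hex + 2 ≤ 4 * Q + 2)).length_le
    have := Nat.find_spec hex
    omega
  obtain ⟨q, hq⟩ : ∃ q, Nat.find hex = q + 1 := ⟨Nat.find hex - 1, by omega⟩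
  have h1 := Nat.find_spec hex
  have h2 := Nat.find_min hex (m := q) (by omega)
  rw [hq] at h1
  rw [not_lt] at h2
  refine ⟨q, by omega, (block (nthString q)).take (n - (concatStrings (4 * q + 2)).length), ?_, ?_⟩
  · rw [seqPrefix_allStringsSeq h1.le, concatStrings_add_four, List.take_append,
      List.take_of_length_le h2]
  · rw [← length_block]
    exact List.length_take_le' _ _

theorem length_concatStrings_le (q : ℕ) :
    (concatStrings (4 * q + 2)).length ≤ (4 * q + 2) * ((nthString q).length + 2) := by
  have : ∀ m ≤ 4 * q + 2, (concatStrings m).length ≤ m * ((nthString q).length + 2) := by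
    intro m hm
    induction m with
    | zero => simp [concatStrings]
    | succ m ih =>
      rw [concatStrings_succ, List.length_append, Nat.succ_mul]
      exact add_le_add (ih (by omega)) (length_nthString_le hm)
  exact this _ le_rfl

/-! ### Counting -/

theorem card_filter_length_le {κ : Type*} [DecidableEq κ] (A : Finset (List Bool × κ))
    (C : Finset κ) (hA : ∀ x ∈ A, x.2 ∈ C) (t : ℕ) :
    (A.filter fun x => x.1.length ≤ t).card ≤ C.card * 2 ^ (t + 1) := by
  have hsub : (A.filter fun x => x.1.length ≤ t) ⊆
      ((Finset.range (2 ^ (t + 1))).image nthString) ×ˢ C := by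
    intro x hx
    rw [Finset.mem_filter] at hx
    obtain ⟨k, hk⟩ := exists_nthString_eq x.1
    refine Finset.mem_product.2 ⟨Finset.mem_image.2 ⟨k, ?_, hk⟩, hA x hx.1⟩
    rw [Finset.mem_range]
    have h1 := lt_two_pow_length_nthString k
    have h2 : 2 ^ ((nthString k).length + 1) ≤ 2 ^ (t + 1) :=
      Nat.pow_le_pow_right (by norm_num) (by rw [hk]; omega)
    omega
  calc _ ≤ _ := Finset.card_le_card hsub
    _ = ((Finset.range (2 ^ (t + 1))).image nthString).card * C.card := Finset.card_product _ _
    _ ≤ 2 ^ (t + 1) * C.card := by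
        gcongr
        exact Finset.card_image_le.trans (by simp)
    _ = _ := mul_comm _ _

/-- Passing from `t` to `t + 1` raises the truncated sum by one for each element whose string is
longer than `t`. The exceptions number at most `C.card * 2 ^ (t + 1)`, which is exactly the growth
of the error term. -/
theorem card_mul_le_sum_min_length {κ : Type*} [DecidableEq κ] (A : Finset (List Bool × κ))
    (C : Finset κ) (hA : ∀ x ∈ A, x.2 ∈ C) (t : ℕ) :
    A.card * t ≤ ∑ x ∈ A, min x.1.length t + C.card * 2 ^ (t + 1) := by
  induction t with
  | zero => simp
  | succ t ih =>
    have h1 := card_filter_length_le A C hA t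
    have h2 : ∑ x ∈ A, min x.1.length (t + 1) + (A.filter fun x => x.1.length ≤ t).card =
        ∑ x ∈ A, min x.1.length t + A.card := by
      rw [Finset.card_filter, ← Finset.sum_add_distrib, Finset.card_eq_sum_ones,
        ← Finset.sum_add_distrib]
      refine Finset.sum_congr rfl fun x _ => ?_
      split_ifs <;> omega
    rw [mul_add, mul_one, pow_succ, ← mul_assoc]
    omega

/-- Strings that are distinct when tagged with elements of a set `C` have a large total length. -/
theorem length_mul_le_sum_length {κ : Type*} [DecidableEq κ] {L : List (List Bool × κ)}
    (hL : L.Nodup) (C : Finset κ) (hC : ∀ x ∈ L, x.2 ∈ C) (t : ℕ) :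
    L.length * t ≤ (L.map fun x => x.1.length).sum + C.card * 2 ^ (t + 1) := by
  have h := card_mul_le_sum_min_length L.toFinset C (by simpa using hC) t
  rw [List.toFinset_card_of_nodup hL] at h
  refine h.trans (Nat.add_le_add_right ?_ _)
  rw [← List.sum_toFinset _ hL]
  exact Finset.sum_le_sum fun x _ => min_le_left _ _

theorem le_length_nthString {c q : ℕ} (h : 2 ^ c ≤ q) : c ≤ (nthString q).length := by
  have h1 := lt_two_pow_length_nthString q
  have : 2 ^ c < 2 ^ ((nthString q).length + 1) := by omega
  have := (Nat.pow_lt_pow_iff_right (by norm_num)).1 this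
  omega

theorem tendsto_length_nthString :
    Filter.Tendsto (fun q => (nthString q).length) Filter.atTop Filter.atTop :=
  Filter.tendsto_atTop.2 fun c =>
    (Filter.eventually_ge_atTop (2 ^ c)).mono fun _ h => le_length_nthString h

/-- The asymptotic form of the counting bound. -/
theorem eventually_le_of_counting (K : ℕ) {ε : ℝ} (hε : 0 < ε) :
    ∀ᶠ q : ℕ in Filter.atTop, ∀ Y n : ℕ,
      (∀ t, (4 * q + 2) * t ≤ Y + K * 2 ^ (t + 1)) →
      n ≤ (4 * q + 2 + 4) * ((nthString q).length + 2) → (1 - ε) * n ≤ Y := by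
  have hlen := tendsto_natCast_atTop_atTop (R := ℝ) |>.comp tendsto_length_nthString
  filter_upwards [hlen.eventually_ge_atTop (2 * (K + 3) / ε),
    tendsto_length_nthString.eventually_ge_atTop (K + 3),
    (tendsto_natCast_atTop_atTop (R := ℝ)).eventually_ge_atTop (8 / ε)] with q h1 h2 h3 Y n hY hn
  obtain hneg | hpos := le_total (1 - ε) 0
  · exact (mul_nonpos_of_nonpos_of_nonneg hneg (Nat.cast_nonneg _)).trans (Nat.cast_nonneg _)
  simp only [Function.comp_apply] at h1
  have hpow := two_pow_length_nthString_le q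
  generalize (nthString q).length = a at *
  -- The counting bound is used at `t = a - K`: since `K < 2 ^ K`, its error term is then at most `2
  -- * 2 ^ a ≤ 4q + 2`, a loss of at most one bit per string.
  obtain ⟨t, rfl⟩ : ∃ t, a = t + K := ⟨a - K, by omega⟩
  have hKt : K * 2 ^ (t + 1) ≤ 4 * q + 2 := by
    have hK : K < 2 ^ K := Nat.lt_two_pow_self
    have : K * 2 ^ (t + 1) ≤ 2 ^ K * 2 ^ (t + 1) := Nat.mul_le_mul_right _ hK.le
    have h' : 2 ^ K * 2 ^ (t + 1) = 2 * 2 ^ (t + K) := by ring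
    omega
  have hY' := hY t
  have hYR : ((4 * q + 2 : ℕ) : ℝ) * t ≤ Y + (4 * q + 2 : ℕ) := by
    exact_mod_cast hY'.trans (Nat.add_le_add_left hKt _)
  have hnR : (n : ℝ) ≤ ((4 * q + 2 : ℕ) + 4) * ((t + K : ℕ) + 2) := by exact_mod_cast hn
  have hm : 8 / ε ≤ ((4 * q + 2 : ℕ) : ℝ) := by
    push_cast
    linarith [Nat.cast_nonneg (α := ℝ) q]
  generalize ((4 * q + 2 : ℕ) : ℝ) = m at *
  rw [div_le_iff₀ hε] at h1 hm
  have hm0 : 0 ≤ m := by nlinarith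
  refine (mul_le_mul_of_nonneg_left hnR hpos).trans ?_
  push_cast at h1 ⊢
  have e1 := mul_le_mul_of_nonneg_left h1 hm0
  have ht : (0 : ℝ) ≤ (t + K : ℝ) + 2 := by positivity
  have e2 := mul_le_mul_of_nonneg_left hm ht
  have e3 : 0 ≤ ε * ((t + K : ℝ) + 2) := by positivity
  have e4 : 0 ≤ ε * m := by positivity
  nlinarith

end PebbleDepth

namespace PebbleDepth

/-! ### Finite-state transducers do not compress the sequence -/

namespace FST

/-- If a transducer, with `a` left over from its last output, writes `w ++ z`, then the part of the
input on which it writes `w` can be split off. -/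
theorem exists_split_of_append_outputFrom_eq (T : FST) {B : ℕ}
    (hB : ∀ q b, (T.out q b).length ≤ B) (y : List Bool) (q : Fin T.numStates)
    (a w z : List Bool) (ha : a.length ≤ B) (h : a ++ T.outputFrom q y = w ++ z) :
    ∃ y₁ y₂ a', y = y₁ ++ y₂ ∧ a ++ T.outputFrom q y₁ = w ++ a' ∧ a'.length ≤ B ∧
      a' ++ T.outputFrom (y₁.foldl T.step q) y₂ = z := by
  induction y generalizing q a w with
  | nil =>
    refine ⟨[], [], z, rfl, h, ?_, by simp [outputFrom]⟩
    have := congrArg List.length h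
    simp [outputFrom] at this
    omega
  | cons b y ih =>
    -- Either the leftover `a` is used up inside `w` and reading goes on, or `a` already contains
    -- `w` and the piece of input for `w` is empty.
    rcases List.append_eq_append_iff.1 h with ⟨w', hw, hz⟩ | ⟨a', ha', hz⟩
    · obtain ⟨y₁, y₂, a', rfl, h1, h2, h3⟩ := ih (T.step q b) (T.out q b) w' (hB q b) hz
      exact ⟨b :: y₁, y₂, a', rfl, by rw [outputFrom, h1, hw, List.append_assoc], h2, h3⟩
    · refine ⟨[], b :: y, a', rfl, by simpa [outputFrom] using ha', ?_, hz.symm⟩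
      have := congrArg List.length ha'
      rw [List.length_append] at this
      omega

/-- The word that is written on the input piece `x.1` from the state `x.2.1`, if `x.2.2.1` is left
over from before and `x.2.2.2` is left over at the end. -/
def decodePiece (T : FST) (x : List Bool × Fin T.numStates × List Bool × List Bool) : List Bool :=
  (x.2.2.1 ++ T.outputFrom x.2.1 x.1).take
    ((x.2.2.1 ++ T.outputFrom x.2.1 x.1).length - x.2.2.2.length)

/-- The input is cut at the first moment when each word is complete. The output of a single step may
overshoot the end of a word, but by at most `B` symbols, which are carried over to the next piece.
-/
theorem exists_pieces (T : FST) {B : ℕ} (hB : ∀ q b, (T.out q b).length ≤ B)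
    (ws : List (List Bool)) (y : List Bool) (q : Fin T.numStates) (a z : List Bool)
    (ha : a.length ≤ B) (h : a ++ T.outputFrom q y = ws.flatten ++ z) :
    ∃ L : List (List Bool × Fin T.numStates × List Bool × List Bool),
      L.map T.decodePiece = ws ∧ (L.map fun x => x.1.length).sum ≤ y.length ∧
        ∀ x ∈ L, x.2.2.1.length ≤ B ∧ x.2.2.2.length ≤ B := by
  induction ws generalizing y q a with
  | nil => exact ⟨[], by simp⟩
  | cons w ws ih =>
    rw [List.flatten_cons, List.append_assoc] at h
    obtain ⟨y₁, y₂, a', rfl, h1, h2, h3⟩ :=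
      T.exists_split_of_append_outputFrom_eq hB y q a w _ ha h
    obtain ⟨L, hL1, hL2, hL3⟩ := ih y₂ _ a' h2 h3
    refine ⟨(y₁, q, a, a') :: L, ?_, ?_, ?_⟩
    · simp [decodePiece, hL1, h1]
    · simpa using hL2
    · intro x hx
      rcases List.mem_cons.1 hx with rfl | hx
      · exact ⟨ha, h2⟩
      · exact hL3 x hx

/-- A transducer needs a long input to write a concatenation of distinct strings. -/
theorem exists_forall_length_mul_le (T : FST) :
    ∃ K : ℕ, ∀ (ws : List (List Bool)) (y z : List Bool), ws.Nodup →
      T.output y = ws.flatten ++ z → ∀ t, ws.length * t ≤ y.length + K * 2 ^ (t + 1) := by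
  obtain ⟨B, hB⟩ : ∃ B, ∀ q b, (T.out q b).length ≤ B :=
    ⟨Finset.univ.sup fun x : Fin T.numStates × Bool => (T.out x.1 x.2).length, fun q b =>
      Finset.le_sup (f := fun x : Fin T.numStates × Bool => (T.out x.1 x.2).length)
        (Finset.mem_univ (q, b))⟩
  have hfin : {a : List Bool | a.length ≤ B}.Finite := List.finite_length_le Bool B
  -- The tags: a state and two leftovers of length at most `B`. Their number depends on `T` only.
  let C : Finset (Fin T.numStates × List Bool × List Bool) :=
    Finset.univ ×ˢ hfin.toFinset ×ˢ hfin.toFinset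
  refine ⟨C.card, fun ws y z hws h t => ?_⟩
  obtain ⟨L, rfl, hL2, hL3⟩ := T.exists_pieces hB ws y T.start [] z (by simp) h
  have hC : ∀ x ∈ L, x.2 ∈ C := fun x hx => by simpa [C] using hL3 x hx
  rw [List.length_map]
  exact (length_mul_le_sum_length (List.Nodup.of_map _ hws) C hC t).trans
    (Nat.add_le_add_right hL2 _)

end FST

/-- The first `m` non-empty strings. -/
def firstStrings (m : ℕ) : List (List Bool) :=
  (List.range m).map fun i => nthString (i + 1)

theorem flatten_firstStrings (m : ℕ) : (firstStrings m).flatten = concatStrings m :=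
  (List.flatMap_def ..).symm

theorem length_firstStrings (m : ℕ) : (firstStrings m).length = m := by simp [firstStrings]

theorem nodup_firstStrings (m : ℕ) : (firstStrings m).Nodup :=
  List.nodup_range.map fun _ _ h => Nat.succ_injective (nthString_injective h)

theorem firstStrings_succ (m : ℕ) :
    firstStrings (m + 1) = firstStrings m ++ [nthString (m + 1)] := by
  simp [firstStrings, List.range_succ]

theorem mem_firstStrings {m j : ℕ} (hj : j ≠ 0) : nthString j ∈ firstStrings m ↔ j ≤ m := by
  simp only [firstStrings, List.mem_map, List.mem_range]
  constructor
  · rintro ⟨i, hi, h⟩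
    have := nthString_injective h
    omega
  · intro h
    exact ⟨j - 1, by omega, by rw [Nat.sub_add_cancel (by omega)]⟩

theorem FST.eventually_le_length_of_output_eq (T : FST) {ε : ℝ} (hε : 0 < ε) :
    ∀ᶠ n : ℕ in Filter.atTop, ∀ y : List Bool, T.output y = seqPrefix allStringsSeq n →
      (1 - ε) * n ≤ y.length := by
  obtain ⟨K, hK⟩ := T.exists_forall_length_mul_le
  obtain ⟨Q, hQ⟩ := Filter.eventually_atTop.1 (eventually_le_of_counting K hε)
  filter_upwards [Filter.eventually_ge_atTop (concatStrings (4 * Q + 2)).length] with n hn y hy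
  obtain ⟨q, hq, tail, h1, h2⟩ := seqPrefix_eq_concatStrings_append hn
  refine hQ q hq _ _ (fun t => ?_) ?_
  · rw [h1, ← flatten_firstStrings] at hy
    simpa [length_firstStrings] using hK _ y tail (nodup_firstStrings _) hy t
  · have h3 := congrArg List.length h1
    simp only [seqPrefix, List.length_map, List.length_range, List.length_append] at h3
    have := length_concatStrings_le q
    rw [h3, add_mul]
    omega

/-! ### The Lempel-Ziv algorithm does not compress the sequence -/

/-- If all non-empty proper prefixes of `v`, appended to the part already read, are in the
dictionary and all of `v` is not, then the current phrase ends exactly with `v`. -/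
theorem lzParseAux_append {D : List (List Bool)} {w v : List Bool} (hv : v ≠ [])
    (hD : ∀ u, u ≠ [] → u <+: v → u ≠ v → w ++ u ∈ D) (hwv : w ++ v ∉ D) (x : List Bool) :
    lzParseAux D w (v ++ x) = lzParseAux (D ++ [w ++ v]) [] x := by
  induction v generalizing w with
  | nil => exact absurd rfl hv
  | cons b v ih =>
    rw [List.cons_append, lzParseAux]
    cases v with
    | nil => rw [if_neg hwv, List.nil_append]
    | cons c v =>
      rw [if_pos (hD [b] (by simp) (by simp) (by simp)), ih (by simp) _ (by simpa using hwv)]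
      · simp
      · intro u hu hp hne
        have := hD (b :: u) (by simp) (by simpa using hp) (by simpa using hne)
        simpa using this

theorem lzParseAux_concatStrings (m : ℕ) (x : List Bool) :
    lzParseAux [] [] (concatStrings m ++ x) = lzParseAux (firstStrings m) [] x := by
  induction m generalizing x with
  | zero => rfl
  | succ m ih =>
    rw [concatStrings_succ, List.append_assoc, ih, lzParseAux_append, firstStrings_succ]
    · simp
    · simp [nthString_succ]
    · intro u hu hp hne
      obtain ⟨j, hj, rfl⟩ := exists_nthString_eq_of_prefix hp
      rw [List.nil_append, mem_firstStrings (by rintro rfl; exact hu nthString_zero)]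
      have : j ≠ m + 1 := fun h => hne (by rw [h])
      omega
    · rw [List.nil_append, mem_firstStrings (by omega)]
      omega

theorem lzPhrases_concatStrings (m : ℕ) : lzPhrases (concatStrings m) = firstStrings m := by
  have := lzParseAux_concatStrings m []
  rw [List.append_nil] at this
  rw [lzPhrases, this, lzParseAux, if_pos rfl]

/-- A phrase is recovered from its pointer code and its last bit. The counting bound is applied to
the pointer codes alone, with the last bit as tag; the constant `3` is the number of elements of
`Option Bool`. -/
theorem length_mul_le_length_lz {c : ℕ → List Bool} (hc : IsPrefixFree c) (m t : ℕ) :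
    m * t ≤ (lz c (concatStrings m)).length + 3 * 2 ^ (t + 1) := by
  let f : List Bool → List Bool × Option Bool := fun p =>
    (c (([] :: firstStrings m).idxOf p.dropLast), p.getLast?)
  have hmem : ∀ p ∈ firstStrings m, p ≠ [] ∧ p.dropLast ∈ [] :: firstStrings m := by
    intro p hp
    simp only [firstStrings, List.mem_map, List.mem_range] at hp
    obtain ⟨i, hi, rfl⟩ := hp
    refine ⟨by simp [nthString_succ], ?_⟩
    obtain ⟨j, hj, h⟩ := exists_nthString_eq_of_prefix (List.dropLast_prefix (nthString (i + 1)))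
    rw [h]
    rcases eq_or_ne j 0 with rfl | h0
    · simp [nthString_zero]
    · exact List.mem_cons_of_mem _ ((mem_firstStrings h0).2 (by omega))
  have hinj : ((firstStrings m).map f).Nodup := by
    refine List.Nodup.map_on (fun p hp p' hp' h => ?_) (nodup_firstStrings m)
    obtain ⟨h1, h2⟩ := Prod.mk.inj h
    have h3 : p.dropLast = p'.dropLast :=
      (List.idxOf_inj (hmem p hp).2).1 (hc _ _ (by rw [h1]))
    rw [List.getLast?_eq_getLast_of_ne_nil (hmem p hp).1,
      List.getLast?_eq_getLast_of_ne_nil (hmem p' hp').1, Option.some.injEq] at h2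
    rw [← List.dropLast_append_getLast (hmem p hp).1, h2, h3, List.dropLast_append_getLast]
  have h := length_mul_le_sum_length hinj Finset.univ (fun _ _ => Finset.mem_univ _) t
  rw [List.length_map, length_firstStrings] at h
  refine h.trans (Nat.add_le_add ?_ (by simp))
  rw [lz, lzPhrases_concatStrings, List.length_flatMap, List.map_map]
  exact List.sum_le_sum fun p _ => by simp [f]

/-- The transducer that copies its input. -/
def FST.copy : FST where
  numStates := 1
  start := 0
  step := fun _ _ => 0
  out := fun _ b => [b]

theorem FST.output_copy (x : List Bool) : FST.copy.output x = x := by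
  have : ∀ q, FST.copy.outputFrom q x = x := by
    induction x with
    | nil => intro q; rfl
    | cons b x ih => intro q; rw [FST.outputFrom, ih]; rfl
  exact this _

theorem FST.isInformationLossless_copy : FST.copy.IsInformationLossless := by
  intro x y h
  simpa [FST.output_copy] using congrArg Prod.fst h

/-- To refute depth `β`, one lossless transducer and arbitrarily long prefixes suffice: here the
copying transducer and prefixes that end with a complete block. -/
theorem lzDepthLT_allStringsSeq {c : ℕ → List Bool} (hc : IsPrefixFree c) {β : ℝ} (hβ : 0 < β) :
    LZDepthLT c allStringsSeq β := by
  intro h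
  obtain ⟨N, hN⟩ := Filter.eventually_atTop.1 (h FST.copy FST.isInformationLossless_copy)
  obtain ⟨q, hq, hqN⟩ := ((eventually_le_of_counting 3 (half_pos hβ)).and
    (Filter.eventually_ge_atTop N)).exists
  have hlen := length_concatStrings_le q
  have hm := le_length_concatStrings (4 * q + 2)
  have h1 := hN (concatStrings (4 * q + 2)).length (by omega)
  rw [seqPrefix_allStringsSeq le_rfl, List.take_length, FST.output_copy] at h1
  have h2 := hq _ (concatStrings (4 * q + 2)).length (length_mul_le_length_lz hc _)
    (hlen.trans (Nat.mul_le_mul_right _ (by omega)))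
  have h3 : (0 : ℝ) < (concatStrings (4 * q + 2)).length := by
    exact_mod_cast (by omega : 0 < (concatStrings (4 * q + 2)).length)
  nlinarith

end PebbleDepth

namespace PebbleDepth

/-! ### A pebble transducer that compresses the sequence -/

/-- The input from which the strings `block r`, for `r` in a list, and then `tail` are written: each
`r` is preceded by the separator `00` and each of its bits by `1`; the separator `01` precedes
`tail`. -/
def blockCode (rs : List (List Bool)) (tail : List Bool) : List Bool :=
  (rs.flatMap fun r => [false, false] ++ r.flatMap fun b => [true, b]) ++ [false, true] ++ tail

/-- The states of the transducer: in `flag`, `sep`, `data` it reads the first bit of a pair, the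
second bit of a separator and the second bit of another pair; in `backData` and `backFlag` it goes
back to the last separator; in `literal` it copies the rest of the input. The argument counts the
copies of the current string that have been written. -/
inductive BlockState where
  | start
  | flag (j : Fin 4)
  | sep (j : Fin 4)
  | data (j : Fin 4)
  | backData (j : Fin 4)
  | backFlag (j : Fin 4)
  | literal
  | halted
  deriving DecidableEq, Fintype

/-- The two bits that precede the copy `j` of `r` in `block r`. -/
def blockPrefix (j : Fin 4) : List Bool :=
  ![[false, false], [true, false], [false, true], [true, true]] j

/-- The new state, the action and the output. -/
def blockStep : BlockState → TapeSymbol → BlockState × PebbleAction × List Bool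
  -- The state `.flag 3` pretends that a fourth copy has just been completed, so the first separator
  -- is treated like all others.
  | .start, _ => (.flag 3, .moveRight, [false, true])
  | .flag j, .bit true => (.data j, .moveRight, [])
  | .flag j, _ => if j = 3 then (.sep 0, .moveRight, []) else (.backData (j + 1), .moveLeft, [])
  | .data j, .bit b => (.flag j, .moveRight, [b])
  | .sep j, .bit false => (.flag j, .moveRight, blockPrefix j)
  | .sep _, .bit true => (.literal, .moveRight, [])
  | .backData j, _ => (.backFlag j, .moveLeft, [])
  | .backFlag j, .bit true => (.backData j, .moveLeft, [])
  | .backFlag j, _ => (.sep j, .moveRight, [])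
  | .literal, .bit b => (.literal, .moveRight, [b])
  -- On a coded input this case occurs only in state `.literal` on the right end marker, where a
  -- move to the left is possible.
  | _, _ => (.halted, .moveLeft, [])

/-- A numbering of the states. -/
noncomputable def BlockState.equivFin : BlockState ≃ Fin (Fintype.card BlockState) :=
  Fintype.equivFin BlockState

/-- A transducer without pebbles that writes `block r` for each `r` coded on its input. -/
noncomputable def blockTransducer : PebbleTransducer where
  numStates := Fintype.card BlockState
  start := BlockState.equivFin .start
  final := {BlockState.equivFin .halted}
  pebbles := 0
  step := fun q a _ =>
    (BlockState.equivFin (blockStep (BlockState.equivFin.symm q) a).1,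
      (blockStep (BlockState.equivFin.symm q) a).2.1)
  out := fun q a _ => (blockStep (BlockState.equivFin.symm q) a).2.2

/-! ### The run on a coded input -/

namespace blockTransducer

/-- The configuration with the given state, head position and output. -/
noncomputable def cfg (s : BlockState) (i : ℕ) (w : List Bool) : blockTransducer.Config :=
  ⟨BlockState.equivFin s, i, [], w⟩

/-- The second configuration can be reached from the first one on input `y`. -/
def Reaches (y : List Bool) (c d : blockTransducer.Config) : Prop :=
  Relation.ReflTransGen (fun c₁ c₂ => blockTransducer.next y c₁ = some c₂) c d

theorem next_right {y : List Bool} {s s' : BlockState} {i : ℕ} {w o : List Bool} {a : TapeSymbol}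
    (hs : s ≠ .halted) (ha : tapeSymbol y i = a) (ha' : a ≠ .rightEnd)
    (h : blockStep s a = (s', .moveRight, o)) :
    blockTransducer.next y (cfg s i w) = some (cfg s' (i + 1) (w ++ o)) := by
  rw [PebbleTransducer.next, dif_neg (fun h1 : (cfg s i w).state ∈ blockTransducer.final =>
    hs (BlockState.equivFin.injective (Finset.mem_singleton.1 h1)))]
  simp [cfg, blockTransducer, ha, h, ha']

theorem next_left {y : List Bool} {s s' : BlockState} {i : ℕ} {w o : List Bool} {a : TapeSymbol}
    (hs : s ≠ .halted) (ha : tapeSymbol y i = a) (ha' : a ≠ .leftEnd)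
    (h : blockStep s a = (s', .moveLeft, o)) :
    blockTransducer.next y (cfg s i w) = some (cfg s' (i - 1) (w ++ o)) := by
  rw [PebbleTransducer.next, dif_neg (fun h1 : (cfg s i w).state ∈ blockTransducer.final =>
    hs (BlockState.equivFin.injective (Finset.mem_singleton.1 h1)))]
  simp [cfg, blockTransducer, ha, h, ha']

theorem tapeSymbol_append (u : List Bool) (b : Bool) (v : List Bool) :
    tapeSymbol (u ++ b :: v) (u.length + 1) = .bit b := by
  simp [tapeSymbol]

theorem tapeSymbol_length (u : List Bool) : tapeSymbol u (u.length + 1) = .rightEnd := by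
  simp [tapeSymbol]

/-- A step to the right. -/
theorem reaches_right {y : List Bool} (u v : List Bool) {b : Bool} {s s' : BlockState} {i : ℕ}
    {w o : List Bool} {d : blockTransducer.Config} (hs : s ≠ .halted) (hy : y = u ++ b :: v)
    (hi : i = u.length + 1) (h : blockStep s (.bit b) = (s', .moveRight, o))
    (hd : Reaches y (cfg s' (i + 1) (w ++ o)) d) : Reaches y (cfg s i w) d :=
  Relation.ReflTransGen.head
    (next_right hs (by rw [hy, hi]; exact tapeSymbol_append u b v) (by simp) h) hd

/-- A step to the left. -/
theorem reaches_left {y : List Bool} (u v : List Bool) {b : Bool} {s s' : BlockState} {i : ℕ}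
    {w o : List Bool} {d : blockTransducer.Config} (hs : s ≠ .halted) (hy : y = u ++ b :: v)
    (hi : i = u.length + 1) (h : blockStep s (.bit b) = (s', .moveLeft, o))
    (hd : Reaches y (cfg s' (i - 1) (w ++ o)) d) : Reaches y (cfg s i w) d :=
  Relation.ReflTransGen.head
    (next_left hs (by rw [hy, hi]; exact tapeSymbol_append u b v) (by simp) h) hd

/-- The pairs that code the bits of `r`. -/
def pairs (r : List Bool) : List Bool :=
  r.flatMap fun b => [true, b]

theorem length_pairs (r : List Bool) : (pairs r).length = 2 * r.length := by
  simp [pairs, mul_comm]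

/-- Like the following lemmas, this is stated backwards, for an arbitrary target `d`, so that
stretches of the run can be chained. Here the head sweeps once over the code of `r` and copies it.
-/
theorem reaches_of_data {y : List Bool} (j : Fin 4) {d : blockTransducer.Config} (v : List Bool)
    (r u w : List Bool) (hy : y = u ++ pairs r ++ v)
    (hd : Reaches y (cfg (.flag j) ((u ++ pairs r).length + 1) (w ++ r)) d) :
    Reaches y (cfg (.flag j) (u.length + 1) w) d := by
  induction r generalizing u w with
  | nil => simpa [pairs] using hd
  | cons b r ih =>
    refine reaches_right u (b :: pairs r ++ v) (b := true) (by simp) (by simp [hy, pairs]) rfl rfl ?_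
    refine reaches_right (u ++ [true]) (pairs r ++ v) (b := b) (by simp) (by simp [hy, pairs])
      (by simp) rfl ?_
    have := ih (u ++ [true, b]) (w ++ [b]) (by simp [hy, pairs]) (by simpa [pairs] using hd)
    simpa using this

/-- Going left from the last square of the code of `r`, the head looks only at the first bit of each
pair, so bits of `r` are not mistaken for a separator. Hence the induction removes bits from the end
of `r`. -/
theorem reaches_of_back {y : List Bool} (j : Fin 4) {d : blockTransducer.Config} (u w : List Bool)
    (r v : List Bool) (hy : y = u ++ [false, false] ++ pairs r ++ v)
    (hd : Reaches y (cfg (.sep j) (u.length + 2) w) d) :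
    Reaches y (cfg (.backData j) (u.length + 2 + 2 * r.length) w) d := by
  induction r using List.reverseRecOn generalizing v with
  | nil =>
    refine reaches_left (u ++ [false]) v (b := false) (by simp) (by simp [hy, pairs]) (by simp)
      rfl ?_
    refine reaches_right u (false :: v) (b := false) (by simp) (by simp [hy, pairs]) (by simp)
      rfl ?_
    simpa using hd
  | append_singleton r b ih =>
    refine reaches_left (u ++ [false, false] ++ pairs r ++ [true]) v (b := b) (by simp)
      (by simp [hy, pairs]) (by simp [length_pairs]; ring) rfl ?_
    refine reaches_left (u ++ [false, false] ++ pairs r) (b :: v) (b := true) (by simp)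
      (by simp [hy, pairs]) (by simp [length_pairs]; ring) rfl ?_
    have := ih (true :: b :: v) (by simp [hy, pairs])
    simpa [mul_add, ← add_assoc] using this

theorem reaches_of_copy {y : List Bool} (j : Fin 4) {d : blockTransducer.Config}
    (u w r v : List Bool) (hy : y = u ++ [false, false] ++ pairs r ++ v)
    (hd : Reaches y
      (cfg (.flag j) (u.length + 2 + 2 * r.length + 1) (w ++ (blockPrefix j ++ r))) d) :
    Reaches y (cfg (.sep j) (u.length + 2) w) d := by
  refine reaches_right (u ++ [false]) (pairs r ++ v) (b := false) (by simp) (by simp [hy])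
    (by simp) rfl ?_
  have := reaches_of_data (y := y) (d := d) j v r (u ++ [false, false]) (w ++ blockPrefix j)
    (by simp [hy]) ?_
  · simpa using this
  · rw [show (u ++ [false, false] ++ pairs r).length + 1 = u.length + 2 + 2 * r.length + 1 by
      simp [length_pairs]; ring]
    simpa using hd

/-- The `false` after the pairs is the first bit of the next separator: it ends the copy and, unless
this was the fourth one, sends the head back. -/
theorem reaches_of_copy_back {y : List Bool} (j : Fin 4) (hj : j ≠ 3)
    {d : blockTransducer.Config} (u w r v : List Bool)
    (hy : y = u ++ [false, false] ++ pairs r ++ false :: v)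
    (hd : Reaches y (cfg (.sep (j + 1)) (u.length + 2) (w ++ (blockPrefix j ++ r))) d) :
    Reaches y (cfg (.sep j) (u.length + 2) w) d := by
  refine reaches_of_copy j u w r _ hy ?_
  refine reaches_left (u ++ [false, false] ++ pairs r) v (b := false) (by simp) hy
    (by simp [length_pairs]; ring) (by simp [blockStep, hj]; exact ⟨rfl, rfl⟩) ?_
  have := reaches_of_back (y := y) (d := d) (j + 1) u (w ++ (blockPrefix j ++ r)) r _ hy hd
  simpa using this

theorem reaches_of_block {y : List Bool} {d : blockTransducer.Config} (u w r v : List Bool)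
    (hy : y = u ++ [false, false] ++ pairs r ++ false :: v)
    (hd : Reaches y (cfg (.sep 0) (u.length + 2 + 2 * r.length + 2) (w ++ block r)) d) :
    Reaches y (cfg (.sep 0) (u.length + 2) w) d := by
  refine reaches_of_copy_back 0 (by decide) u w r v hy ?_
  refine reaches_of_copy_back 1 (by decide) u _ r v hy ?_
  refine reaches_of_copy_back 2 (by decide) u _ r v hy ?_
  refine reaches_of_copy 3 u _ r _ hy ?_
  refine reaches_right (u ++ [false, false] ++ pairs r) v (b := false) (by simp) hy
    (by simp [length_pairs]; ring) rfl ?_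
  simpa [block, blockPrefix] using hd

theorem reaches_of_literal (tail u w : List Bool) :
    ∃ i, Reaches (u ++ tail) (cfg .literal (u.length + 1) w) (cfg .halted i (w ++ tail)) := by
  induction tail generalizing u w with
  | nil =>
    refine ⟨u.length, Relation.ReflTransGen.single ?_⟩
    simpa using next_left (y := u) (w := w) (s := .literal) (by simp) (tapeSymbol_length u)
      (by simp) rfl
  | cons b tail ih =>
    obtain ⟨i, hi⟩ := ih (u ++ [b]) (w ++ [b])
    refine ⟨i, reaches_right u tail (by simp) rfl rfl rfl ?_⟩
    simpa using hi

theorem blockCode_cons (r : List Bool) (rs : List (List Bool)) (tail : List Bool) :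
    blockCode (r :: rs) tail = [false, false] ++ pairs r ++ blockCode rs tail := by
  simp [blockCode, pairs]

theorem exists_blockCode_eq_cons (rs : List (List Bool)) (tail : List Bool) :
    ∃ v, blockCode rs tail = false :: v := by
  cases rs with
  | nil => exact ⟨_, rfl⟩
  | cons r rs => exact ⟨_, by rw [blockCode_cons]; rfl⟩

theorem reaches_of_blocks (rs : List (List Bool)) (tail u w : List Bool) :
    ∃ i, Reaches (u ++ blockCode rs tail) (cfg (.sep 0) (u.length + 2) w)
      (cfg .halted i (w ++ (rs.flatMap block ++ tail))) := by
  induction rs generalizing u w with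
  | nil =>
    obtain ⟨i, hi⟩ := reaches_of_literal tail (u ++ [false, true]) w
    refine ⟨i, reaches_right (u ++ [false]) tail (b := true) (by simp) (by simp [blockCode])
      (by simp) rfl ?_⟩
    simpa [blockCode] using hi
  | cons r rs ih =>
    obtain ⟨i, hi⟩ := ih (u ++ [false, false] ++ pairs r) (w ++ block r)
    obtain ⟨v, hv⟩ := exists_blockCode_eq_cons rs tail
    refine ⟨i, reaches_of_block u w r v (by rw [blockCode_cons, hv]; simp) ?_⟩
    rw [blockCode_cons]
    rw [show (u ++ [false, false] ++ pairs r).length + 2 = u.length + 2 + 2 * r.length + 2 by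
      simp [length_pairs]; ring] at hi
    simpa using hi

theorem outputs (rs : List (List Bool)) (tail : List Bool) :
    blockTransducer.Outputs (blockCode rs tail) ([false, true] ++ rs.flatMap block ++ tail) := by
  obtain ⟨i, hi⟩ := reaches_of_blocks rs tail [] [false, true]
  obtain ⟨v, hv⟩ := exists_blockCode_eq_cons rs tail
  refine ⟨cfg .halted i ([false, true] ++ (rs.flatMap block ++ tail)), ?_, ?_, ?_⟩
  · refine Relation.ReflTransGen.head (b := cfg (.flag 3) 1 [false, true])
      (next_right (s := .start) (i := 0) (w := []) (a := .leftEnd) (by simp) rfl (by simp) rfl) ?_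
    exact reaches_right [] v (by simp) hv rfl rfl hi
  · exact Finset.mem_singleton_self _
  · simp [cfg]

end blockTransducer

/-! ### The compression rate -/

theorem two_mul_length_blockCode_le (rs : List (List Bool)) (tail : List Bool) :
    2 * (blockCode rs tail).length ≤ (rs.flatMap block).length + 2 * tail.length + 4 := by
  induction rs with
  | nil => simp [blockCode]; omega
  | cons r rs ih =>
    rw [blockTransducer.blockCode_cons, List.flatMap_cons]
    simp only [List.length_append, blockTransducer.length_pairs, length_block, List.length_cons,
      List.length_nil] at *
    omega

theorem sq_le_two_pow {n : ℕ} (h : 4 ≤ n) : n ^ 2 ≤ 2 ^ n := by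
  induction n, h using Nat.le_induction with
  | base => norm_num
  | succ n hn ih => rw [pow_succ 2 n]; nlinarith

/-- Complete blocks cost at most half their length and the tail costs its full length, at most `4 *
l` with `l = |nthString q| + 2`. As `l ^ 2 ≤ 2 ^ l ≤ n + 2`, the tail is negligible. -/
theorem eventually_exists_outputs {ε : ℝ} (hε : 0 < ε) :
    ∀ᶠ n : ℕ in Filter.atTop, ∃ y : List Bool,
      blockTransducer.Outputs y (seqPrefix allStringsSeq n) ∧ y.length ≤ (1 / 2 + ε) * n := by
  have hlen := tendsto_natCast_atTop_atTop (R := ℝ) |>.comp tendsto_length_nthString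
  obtain ⟨Q, hQ⟩ := Filter.eventually_atTop.1 ((hlen.eventually_ge_atTop (12 / ε)).and
    (tendsto_length_nthString.eventually_ge_atTop 2))
  filter_upwards [Filter.eventually_ge_atTop (concatStrings (4 * Q + 2)).length] with n hn
  obtain ⟨q, hq, tail, h1, h2⟩ := seqPrefix_eq_concatStrings_append hn
  obtain ⟨h3, h4⟩ := hQ q hq
  refine ⟨blockCode ((List.range q).map nthString) tail, ?_, ?_⟩
  · rw [h1, concatStrings_eq_blocks]
    exact blockTransducer.outputs _ _
  have h5 := two_mul_length_blockCode_le ((List.range q).map nthString) tail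
  have h6 := congrArg List.length h1
  have h7 := le_length_concatStrings (4 * q + 2)
  have h8 := congrArg List.length (concatStrings_eq_blocks q)
  simp only [seqPrefix, List.length_map, List.length_range, List.length_append,
    List.length_cons, List.length_nil] at h6 h8
  have h9 := sq_le_two_pow (n := (nthString q).length + 2) (by omega)
  have h10 := two_pow_length_nthString_le q
  rw [pow_add 2] at h9
  simp only [Function.comp_apply] at h3
  set l := (nthString q).length + 2 with hl
  have h3' : 12 / ε ≤ (l : ℝ) := h3.trans (by rw [hl]; push_cast; linarith)
  have h11 : l ^ 2 ≤ n + 2 := by omega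
  have h12 : 2 * (blockCode ((List.range q).map nthString) tail).length ≤ n + 4 * l + 2 := by
    omega
  have h13 : 4 ≤ l := by omega
  rw [div_le_iff₀ hε] at h3'
  have h11' : (l : ℝ) ^ 2 ≤ n + 2 := by exact_mod_cast h11
  have h12' : 2 * ((blockCode ((List.range q).map nthString) tail).length : ℝ) ≤
      n + 4 * l + 2 := by exact_mod_cast h12
  have h13' : (4 : ℝ) ≤ l := by exact_mod_cast h13
  have h14 : (l : ℝ) ^ 2 ≤ 2 * n := by nlinarith
  nlinarith

end PebbleDepth

namespace PebbleDepth

/-! ### The depth of the sequence -/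

namespace BinaryRepresentation

variable {F : Type} [TransducerClass F]

/-- Only finitely many descriptions have length at most `k`. So an asymptotic bound for each single
transducer holds from some point on for all those of size at most `k`. -/
theorem finite_setOf_size_le (σ : BinaryRepresentation F) (k : ℕ) :
    {T : F | σ.size T ≤ k}.Finite := by
  have hfin : {x : σ.dom | (x : List Bool).length ≤ k}.Finite :=
    (List.finite_length_le Bool k).preimage Subtype.val_injective.injOn
  refine (hfin.image σ.toFun).subset fun T hT => ?_
  obtain ⟨x, hx⟩ := σ.surjective_toFun T
  obtain ⟨z, hz, hzl⟩ := Nat.sInf_mem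
    (s := {m : ℕ | ∃ x : σ.dom, σ.toFun x = T ∧ (x : List Bool).length = m}) ⟨_, x, hx, rfl⟩
  exact ⟨z, hzl.trans_le hT, hz⟩

theorem complexity_le (σ : BinaryRepresentation F) {T : F} {x y : List Bool}
    (h : TransducerClass.Outputs T y x) : σ.complexity (σ.size T) x ≤ y.length :=
  sInf_le ⟨T, y, le_rfl, h, rfl⟩

theorem eq_top_or_exists_complexity_eq (σ : BinaryRepresentation F) (k : ℕ) (x : List Bool) :
    σ.complexity k x = ⊤ ∨ ∃ (T : F) (y : List Bool), σ.size T ≤ k ∧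
      TransducerClass.Outputs T y x ∧ σ.complexity k x = y.length := by
  rcases Set.eq_empty_or_nonempty {m : ℕ∞ | ∃ (T : F) (y : List Bool),
    σ.size T ≤ k ∧ TransducerClass.Outputs T y x ∧ m = (y.length : ℕ∞)} with h | h
  · left
    rw [complexity, h, sInf_empty]
  · right
    exact csInf_mem h

end BinaryRepresentation

theorem pbDepthGE_allStringsSeq (σFS : BinaryRepresentation FST)
    (σPB : BinaryRepresentation PebbleTransducer) {β : ℝ} (hβ : 0 < β) :
    PBDepthGE σFS σPB allStringsSeq (1 / 2 - β) := by
  intro k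
  refine ⟨σPB.size blockTransducer, ?_⟩
  filter_upwards [(Filter.eventually_all_finite (σFS.finite_setOf_size_le k)).2 fun T _ =>
    T.eventually_le_length_of_output_eq (half_pos hβ), eventually_exists_outputs (half_pos hβ)]
    with n h1 ⟨y, hy, hyn⟩
  have h2 := σPB.complexity_le hy
  obtain ⟨b, hb⟩ := ENat.ne_top_iff_exists.1 (h2.trans_lt (ENat.natCast_lt_top _)).ne
  rw [← hb, Nat.cast_le] at h2
  rw [← hb]
  have hbR : (b : ℝ) ≤ y.length := by exact_mod_cast h2
  -- The pebble complexity is finite, so an infinite finite-state complexity makes the difference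
  -- `⊤`. Otherwise the two errors `β / 2` add up: `(1 - β / 2) - (1 / 2 + β / 2) = 1 / 2 - β`.
  rcases σFS.eq_top_or_exists_complexity_eq k (seqPrefix allStringsSeq n) with
    h | ⟨T, z, hT, hz, h⟩
  · rw [h]
    simp
  · have h3 := h1 T hT z hz
    rw [h]
    have : (1 / 2 - β) * n ≤ (z.length : ℝ) - b := by linarith
    have hcast : ∀ m : ℕ, (((m : ℕ∞) : ENNReal) : EReal) = ((m : ℝ) : EReal) :=
      fun m => by rw [ENat.toENNReal_coe]; rfl
    rw [hcast, hcast, ← EReal.coe_sub]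
    exact EReal.coe_le_coe_iff.2 this

end PebbleDepth

theorem mainTheorem4 (β : ℝ) (hβ0 : 0 < β) (hβ1 : β < 1 / 2) :
    ∃ S : ℕ → Bool,
      (∀ (σFS : PebbleDepth.BinaryRepresentation PebbleDepth.FST)
          (σPB : PebbleDepth.BinaryRepresentation PebbleDepth.PebbleTransducer),
          PebbleDepth.PBDepthGE σFS σPB S (1 / 2 - β)) ∧
        (∀ c : ℕ → List Bool, PebbleDepth.IsPrefixFree c → PebbleDepth.LZDepthLT c S β) :=
  ⟨PebbleDepth.allStringsSeq,
    fun σFS σPB => PebbleDepth.pbDepthGE_allStringsSeq σFS σPB hβ0,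
    fun _ hc => PebbleDepth.lzDepthLT_allStringsSeq hc hβ0⟩
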